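/- In one-server Private Information Retrieval (PIR), the user has an index $i\in[n]$, the server has a database $x\in\{0,1\}^n$, and the user has to output $x_i$. A quantum protocol for this task (without prior entanglement) uses the user's workspace $A$, a message register $M$ and the server's workspace $B$, all made of qubits initially in state $|0\rangle$. In round $k=1,2,\dots$ one player (the user if $k$ is odd, the server if $k$ is even) applies a unitary depending on his classical input to his workspace and $M$, and sends $M$ to the other player. After the last round (a message of the server) the user obtains his output by a measurement of $A$ and $M$. The communication complexity is the total number of qubits sent. Let the classical registers $I,X$ hold the inputs $(i,x)$, drawn from a distribution $\mu$, and let $A_k,M_k,B_k$ denote the registers $A,M,B$ at round $k$. The privacy losses (amounts of information leaked) of the user and of the server are $$L_U=\sum_{k\text{ odd}} I(M_k:I\mid X,B_k),\qquad L_S=\sum_{k\text{ even}} I(M_k:X\mid I,A_k),$$ where $I(P:Q\mid R)=S(PR)+S(QR)-S(R)-S(PQR)$ and $S$ is the von Neumann entropy in bits. **Corollary.** There exists a one-server quantum protocol for Private Information Retrieval (one for each database size $n$; the user outputs $x_i$ with certainty for all $i$ and $x$) with communication complexity $O(\log^2(n)\cdot\log\log(n))$, such that, for every input distribution $\mu$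 (in particular the uniform one): - the user leaks no information: $L_U=0$; - the server leaks $O(\mathrm{polylog}(n))$ information: $L_S\le C\,(\log n)^{c}$ for all large $n$, where the constants $c, C$ depend neither on $n$ nor on $\mu$. -/

import Mathlib

open scoped Matrix
open Filter Asymptotics

noncomputable section

namespace QPIR

/-! ### Reduced states, entropy and conditional mutual information -/

/-- Partial trace. The index type `ι` of a composite register is split by `e` into a part `κ`
which is kept and a part `τ` which is traced out. -/
def reducedState {ι κ τ : Type} [Fintype τ] (e : ι ≃ κ × τ) (ρ : Matrix ι ι ℂ) :
    Matrix κ κ ℂ :=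
  Matrix.of fun a a' => ∑ t, ρ (e.symm (a, t)) (e.symm (a', t))

theorem reducedState_isHermitian {ι κ τ : Type} [Fintype τ] (e : ι ≃ κ × τ)
    {ρ : Matrix ι ι ℂ} (h : ρ.IsHermitian) : (reducedState e ρ).IsHermitian := by
  ext a a'
  simp only [reducedState, Matrix.conjTranspose_apply, Matrix.of_apply, star_sum]
  exact Finset.sum_congr rfl fun t _ => h.apply _ _

/-- The von Neumann entropy `S(ρ) = - Tr (ρ log₂ ρ)`, in bits, computed from the spectrum of `ρ`.
It is only used for density matrices, which are Hermitian; on other matrices it is set to `0`. -/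
def entropy {ι : Type} [Fintype ι] [DecidableEq ι] (ρ : Matrix ι ι ℂ) : ℝ :=
  open Classical in
  if h : ρ.IsHermitian then (∑ j, Real.negMulLog (h.eigenvalues j)) / Real.log 2 else 0

/-- For a state `ρ` of three registers `P`, `Q`, `R` (in this order), the conditional mutual
information `I(P : Q | R) = S(PR) + S(QR) - S(R) - S(PQR)`. -/
def condMutualInfo {P Q R : Type} [Fintype P] [DecidableEq P] [Fintype Q] [DecidableEq Q]
    [Fintype R] [DecidableEq R] (ρ : Matrix (P × Q × R) (P × Q × R) ℂ) : ℝ :=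
  entropy (reducedState
      (⟨fun s => ((s.1, s.2.2), s.2.1), fun s => (s.1.1, s.2, s.1.2),
        fun _ => rfl, fun _ => rfl⟩ : P × Q × R ≃ (P × R) × Q) ρ)
    + entropy (reducedState (Equiv.prodComm P (Q × R)) ρ)
    - entropy (reducedState
      (⟨fun s => (s.2.2, (s.1, s.2.1)), fun s => (s.2.1, s.2.2, s.1),
        fun _ => rfl, fun _ => rfl⟩ : P × Q × R ≃ R × (P × Q)) ρ)
    - entropy ρ

/-! ### Two-party quantum protocols -/

/-- The computational basis of a register of `q` qubits. -/
abbrev Bits (q : ℕ) : Type := Fin q → Bool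

/-- A two-party quantum protocol without prior entanglement, where Alice has a classical input in
`X`, Bob has a classical input in `Y`, and Alice outputs an element of `Z`.

There are three registers of qubits: Alice's workspace `A`, the message register `M` and Bob's
workspace `B`. In round `k = 1, …, rounds` one player (Alice if `k` is odd, Bob if `k` is even)
applies a unitary, which may depend on his input, to his workspace and the message register, and
then sends the message register to the other player. The last message is sent by Bob. Then Alice
applies a unitary `aliceFinal` to `A` and `M`, measures these registers in the computational basis
and computes her output from the outcome and her input.

Only the values `aliceOp k` for `k` odd and `bobOp k` for `k` even are used. -/
structure Protocol (X Y Z : Type) where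
  qubitsA : ℕ
  qubitsM : ℕ
  qubitsB : ℕ
  rounds : ℕ
  rounds_even : Even rounds
  aliceOp : ℕ → X → Matrix.unitaryGroup (Bits qubitsA × Bits qubitsM) ℂ
  bobOp : ℕ → Y → Matrix.unitaryGroup (Bits qubitsM × Bits qubitsB) ℂ
  aliceFinal : X → Matrix.unitaryGroup (Bits qubitsA × Bits qubitsM) ℂ
  output : X → Bits qubitsA × Bits qubitsM → Z

namespace Protocol

variable {X Y Z : Type}

/-- The computational basis of Alice's workspace. -/
abbrev RegA (π : Protocol X Y Z) : Type := Bits π.qubitsA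

/-- The computational basis of the message register. -/
abbrev RegM (π : Protocol X Y Z) : Type := Bits π.qubitsM

/-- The computational basis of Bob's workspace. -/
abbrev RegB (π : Protocol X Y Z) : Type := Bits π.qubitsB

/-- The vectors of amplitudes of the three registers `A`, `M`, `B`. -/
abbrev Ket (π : Protocol X Y Z) : Type := π.RegA × π.RegM × π.RegB → ℂ

/-- The operator `U ⊗ 1` applied to a vector, where `U` acts on `A` and `M`. -/
def applyAlice (π : Protocol X Y Z) (U : Matrix.unitaryGroup (π.RegA × π.RegM) ℂ) (φ : π.Ket) :
    π.Ket :=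
  fun s => ((U : Matrix (π.RegA × π.RegM) (π.RegA × π.RegM) ℂ) *ᵥ
    fun r => φ (r.1, r.2, s.2.2)) (s.1, s.2.1)

/-- The operator `1 ⊗ V` applied to a vector, where `V` acts on `M` and `B`. -/
def applyBob (π : Protocol X Y Z) (V : Matrix.unitaryGroup (π.RegM × π.RegB) ℂ) (φ : π.Ket) :
    π.Ket :=
  fun s => ((V : Matrix (π.RegM × π.RegB) (π.RegM × π.RegB) ℂ) *ᵥ
    fun r => φ (s.1, r)) s.2

/-- The pure state of the registers `A`, `M`, `B` at round `k` (after the unitary of round `k`) on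
inputs `x`, `y`. Initially all the qubits are in the state `0`. -/
def state (π : Protocol X Y Z) (x : X) (y : Y) : ℕ → π.Ket
  | 0 => Pi.single ((fun _ => false), (fun _ => false), (fun _ => false)) 1
  | k + 1 =>
    if Odd (k + 1) then π.applyAlice (π.aliceOp (k + 1) x) (π.state x y k)
    else π.applyBob (π.bobOp (k + 1) y) (π.state x y k)

/-- The number of qubits exchanged: each round consists in sending the register `M`. -/
def communication (π : Protocol X Y Z) : ℕ := π.rounds * π.qubitsM

/-- The probability that Alice outputs `z` on inputs `x`, `y`. -/
def outputProb [DecidableEq Z] (π : Protocol X Y Z) (x : X) (y : Y) (z : Z) : ℝ :=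
  ∑ s : π.RegA × π.RegM × π.RegB,
    if π.output x (s.1, s.2.1) = z
    then ‖π.applyAlice (π.aliceFinal x) (π.state x y π.rounds) s‖ ^ 2 else 0

/-- Alice's output is `f x y` with certainty, for all inputs. -/
def Computes [DecidableEq Z] (π : Protocol X Y Z) (f : X → Y → Z) : Prop :=
  ∀ x y, π.outputProb x y (f x y) = 1

/-- The joint state
`∑ x y, μ (x, y) • |x⟩⟨x| ⊗ |y⟩⟨y| ⊗ |φ x y⟩⟨φ x y|`
of the classical input registers `X`, `Y` and the registers `A`, `M`, `B` at round `k`, when the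
inputs are distributed according to `μ`. -/
def jointState [DecidableEq X] [DecidableEq Y] (π : Protocol X Y Z) (μ : X × Y → ℝ) (k : ℕ) :
    Matrix (X × Y × π.RegA × π.RegM × π.RegB) (X × Y × π.RegA × π.RegM × π.RegB) ℂ :=
  Matrix.of fun s t =>
    if s.1 = t.1 ∧ s.2.1 = t.2.1
    then (μ (s.1, s.2.1) : ℂ) * π.state s.1 s.2.1 k s.2.2 * star (π.state s.1 s.2.1 k t.2.2)
    else 0

theorem jointState_isHermitian [DecidableEq X] [DecidableEq Y] (π : Protocol X Y Z)
    (μ : X × Y → ℝ) (k : ℕ) : (π.jointState μ k).IsHermitian := by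
  ext ⟨x, y, s⟩ ⟨x', y', t⟩
  simp only [jointState, Matrix.conjTranspose_apply, Matrix.of_apply]
  by_cases h : x = x' ∧ y = y'
  · obtain ⟨rfl, rfl⟩ := h
    simp
    ring
  · have h' : ¬ (x' = x ∧ y' = y) := fun h' => h ⟨h'.1.symm, h'.2.symm⟩
    simp [h, h']

variable [Fintype X] [DecidableEq X] [Fintype Y] [DecidableEq Y]

/-- Alice's privacy loss `∑_{k odd} I(M_k : X | Y, B_k)` under the input distribution `μ`. -/
def lossA (π : Protocol X Y Z) (μ : X × Y → ℝ) : ℝ :=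
  ∑ k ∈ (Finset.Icc 1 π.rounds).filter (fun k => Odd k),
    condMutualInfo (reducedState
      (⟨fun s => ((s.2.2.2.1, s.1, (s.2.1, s.2.2.2.2)), s.2.2.1),
        fun s => (s.1.2.1, s.1.2.2.1, s.2, s.1.1, s.1.2.2.2),
        fun _ => rfl, fun _ => rfl⟩ :
        X × Y × π.RegA × π.RegM × π.RegB ≃ (π.RegM × X × (Y × π.RegB)) × π.RegA)
      (π.jointState μ k))

/-- Bob's privacy loss `∑_{k even} I(M_k : Y | X, A_k)` under the input distribution `μ`. -/
def lossB (π : Protocol X Y Z) (μ : X × Y → ℝ) : ℝ :=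
  ∑ k ∈ (Finset.Icc 1 π.rounds).filter (fun k => Even k),
    condMutualInfo (reducedState
      (⟨fun s => ((s.2.2.2.1, s.2.1, (s.1, s.2.2.1)), s.2.2.2.2),
        fun s => (s.1.2.2.1, s.1.2.1, s.1.2.2.2, s.1.1, s.2),
        fun _ => rfl, fun _ => rfl⟩ :
        X × Y × π.RegA × π.RegM × π.RegB ≃ (π.RegM × Y × (X × π.RegA)) × π.RegB)
      (π.jointState μ k))

end Protocol

/-- The index function of Private Information Retrieval: the user (Alice) has an index `i`, the
server (Bob) has a database `x` of `n` bits, and the user outputs the bit `x i`. -/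
def index (n : ℕ) (i : Fin n) (x : Fin n → Bool) : Bool := x i

end QPIR

end

/-!
A message register of `q` qubits carries at most `2 q` bits of conditional mutual information, and
the server sends half of the messages, so his loss is at most the communication. It is therefore
enough to find a cheap protocol in which every message of the user is maximally mixed, whatever the
index.

Let `F` be the field with `2 ^ s` elements, where `2 ^ s ≥ ⌈log₂ n⌉ + 2`. The user knows the point
`u` of `F ^ ⌈log₂ n⌉` at which the multilinear extension of the database takes the value `x i`. He
chooses a random direction `r` and asks for the values of the extension at `u + ζ ^ j • r`, where
`ζ` generates the units of `F`. The restriction to the line through `u` is a polynomial of degree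
smaller than the order of `ζ`, so the sum of these values is a nonzero multiple of its value at `u`.
Every query is uniformly distributed. The message register holds a single query and the running sum
of the answers, masked by a uniformly random field element; the queries can replace each other in
place because the user holds `r` in superposition.
-/

namespace QPIR

open scoped ComplexOrder Kronecker

/-! ### Shannon entropy -/

theorem sum_negMulLog_le {ι : Type*} [Fintype ι] {w : ι → ℝ} (hw : ∀ j, 0 ≤ w j) :
    ∑ j, Real.negMulLog (w j) ≤
      Real.negMulLog (∑ j, w j) + (∑ j, w j) * Real.log (Fintype.card ι) := by
  rcases isEmpty_or_nonempty ι with h | h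
  · simp
  have hcard : (0 : ℝ) < Fintype.card ι := by exact_mod_cast Fintype.card_pos
  have jensen := Real.concaveOn_negMulLog.le_map_sum (t := Finset.univ)
    (w := fun _ : ι => (Fintype.card ι : ℝ)⁻¹) (p := w) (fun _ _ => by positivity)
    (by simp [hcard.ne']) (fun j _ => hw j)
  simp only [smul_eq_mul, ← Finset.mul_sum] at jensen
  rw [Real.negMulLog_mul, Real.negMulLog, Real.log_inv] at jensen
  have := mul_le_mul_of_nonneg_left jensen hcard.le
  field_simp at this
  linarith

theorem sum_map_le_sum_map_mulVec_of_mem_doublyStochastic {ι : Type*} [Fintype ι] [DecidableEq ι]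
    {s : Set ℝ} {f : ℝ → ℝ} (hf : ConcaveOn ℝ s f) {D : Matrix ι ι ℝ}
    (hD : D ∈ doublyStochastic ℝ ι) {w : ι → ℝ} (hw : ∀ j, w j ∈ s) :
    ∑ j, f (w j) ≤ ∑ i, f ((D *ᵥ w) i) :=
  calc ∑ j, f (w j) = ∑ j, ∑ i, D i j * f (w j) := by
        simp only [← Finset.sum_mul, sum_col_of_mem_doublyStochastic hD, one_mul]
    _ = ∑ i, ∑ j, D i j * f (w j) := Finset.sum_comm
    _ ≤ ∑ i, f ((D *ᵥ w) i) := Finset.sum_le_sum fun i _ =>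
        hf.le_map_sum (fun _ _ => nonneg_of_mem_doublyStochastic hD)
          (sum_row_of_mem_doublyStochastic hD i) fun j _ => hw j

theorem normSq_mem_doublyStochastic {ι : Type*} [Fintype ι] [DecidableEq ι]
    (U : Matrix.unitaryGroup ι ℂ) :
    Matrix.of (fun i j => Complex.normSq (U i j)) ∈ doublyStochastic ℝ ι := by
  refine mem_doublyStochastic_iff_sum.mpr
    ⟨fun _ _ => Complex.normSq_nonneg _, fun i => ?_, fun j => ?_⟩ <;>
  apply Complex.ofReal_injective
  · have h := congrFun (congrFun (Unitary.coe_mul_star_self U) i) i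
    simpa [Matrix.mul_apply, Complex.mul_conj] using h
  · have h := congrFun (congrFun (Unitary.coe_star_mul_self U) j) j
    simpa [Matrix.mul_apply, Complex.normSq_eq_conj_mul_self] using h

/-! ### Reduced states -/

section ReducedState

variable {ι κ τ : Type} [Fintype τ]

theorem reducedState_posSemidef (e : ι ≃ κ × τ) {ρ : Matrix ι ι ℂ} (h : ρ.PosSemidef) :
    (reducedState e ρ).PosSemidef := by
  have : reducedState e ρ =
      ∑ t, ρ.submatrix (fun a => e.symm (a, t)) (fun a => e.symm (a, t)) := by
    ext a a'
    simp [reducedState, Matrix.sum_apply]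
  rw [this]
  exact Matrix.posSemidef_sum _ fun t _ => h.submatrix _

theorem trace_reducedState [Fintype ι] [Fintype κ] (e : ι ≃ κ × τ) (ρ : Matrix ι ι ℂ) :
    (reducedState e ρ).trace = ρ.trace := by
  simp only [Matrix.trace, Matrix.diag, reducedState, Matrix.of_apply]
  rw [← Fintype.sum_prod_type' (f := fun a t => ρ (e.symm (a, t)) (e.symm (a, t)))]
  exact e.symm.sum_comp fun s => ρ s s

theorem reducedState_conj_kronecker_one [Fintype κ] [DecidableEq τ] (W : Matrix κ κ ℂ)
    (ρ : Matrix (κ × τ) (κ × τ) ℂ) :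
    reducedState (Equiv.refl _)
      ((W ⊗ₖ (1 : Matrix τ τ ℂ)) * ρ * (W ⊗ₖ (1 : Matrix τ τ ℂ))ᴴ) =
      W * reducedState (Equiv.refl _) ρ * Wᴴ := by
  have left : ∀ M : Matrix (κ × τ) (κ × τ) ℂ, reducedState (Equiv.refl _)
      (W ⊗ₖ (1 : Matrix τ τ ℂ) * M) = W * reducedState (Equiv.refl _) M := by
    intro M
    ext a a'
    simp only [reducedState, Matrix.of_apply, Matrix.mul_apply, Fintype.sum_prod_type,
      Matrix.kroneckerMap_apply, Matrix.one_apply, Equiv.refl_symm, Equiv.refl_apply,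
      mul_ite, mul_one, mul_zero, ite_mul, zero_mul, Finset.sum_ite_eq, Finset.mem_univ, if_true,
      Finset.mul_sum]
    exact Finset.sum_comm
  have right : ∀ M : Matrix (κ × τ) (κ × τ) ℂ, reducedState (Equiv.refl _)
      (M * (W ⊗ₖ (1 : Matrix τ τ ℂ))ᴴ) = reducedState (Equiv.refl _) M * Wᴴ := by
    intro M
    ext a a'
    simp only [reducedState, Matrix.of_apply, Matrix.mul_apply, Fintype.sum_prod_type,
      Matrix.conjTranspose_apply, Matrix.kroneckerMap_apply, Matrix.one_apply, Equiv.refl_symm,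
      Equiv.refl_apply, mul_ite, mul_one, mul_zero, apply_ite star, star_zero, Finset.sum_ite_eq,
      Finset.mem_univ, if_true, Finset.sum_mul]
    exact Finset.sum_comm
  rw [right, left]

end ReducedState

/-! ### Von Neumann entropy -/

section Entropy

variable {ι κ τ : Type} [Fintype ι] [DecidableEq ι] [Fintype κ] [DecidableEq κ] [Fintype τ]

theorem entropy_eq_sum_eigenvalues {ρ : Matrix ι ι ℂ} (h : ρ.IsHermitian) :
    entropy ρ = (∑ j, Real.negMulLog (h.eigenvalues j)) / Real.log 2 :=
  dif_pos h

theorem entropy_eq_sum_roots {ρ : Matrix ι ι ℂ} (h : ρ.IsHermitian) :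
    entropy ρ = (ρ.charpoly.roots.map fun z => Real.negMulLog z.re).sum / Real.log 2 := by
  rw [entropy_eq_sum_eigenvalues h, h.roots_charpoly_eq_eigenvalues, Multiset.map_map]
  rfl

theorem entropy_reindex (e : ι ≃ κ) {ρ : Matrix ι ι ℂ} (h : ρ.IsHermitian) :
    entropy (Matrix.reindex e e ρ) = entropy ρ := by
  rw [entropy_eq_sum_roots h, entropy_eq_sum_roots (ρ := Matrix.reindex e e ρ) (h.submatrix e.symm),
    Matrix.charpoly_reindex]

theorem entropy_mul_comm {A : Matrix ι κ ℂ} {B : Matrix κ ι ℂ} (hAB : (A * B).IsHermitian)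
    (hBA : (B * A).IsHermitian) : entropy (A * B) = entropy (B * A) := by
  have sum_roots : ∀ (k : ℕ) {p : Polynomial ℂ}, p.Monic →
      ((Polynomial.X ^ k * p).roots.map fun z : ℂ => Real.negMulLog z.re).sum =
        (p.roots.map fun z : ℂ => Real.negMulLog z.re).sum := by
    intro k p hp
    rw [Polynomial.roots_mul ((Polynomial.monic_X_pow k).mul hp).ne_zero, Polynomial.roots_X_pow]
    simp [Multiset.map_nsmul, Multiset.sum_nsmul]
  rw [entropy_eq_sum_roots hAB, entropy_eq_sum_roots hBA,
    ← sum_roots (Fintype.card κ) (Matrix.charpoly_monic _), Matrix.charpoly_mul_comm',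
    sum_roots _ (Matrix.charpoly_monic _)]

theorem entropy_diagonal (d : ι → ℝ) :
    entropy (Matrix.diagonal fun j => (d j : ℂ)) = (∑ j, Real.negMulLog (d j)) / Real.log 2 := by
  have h : (Matrix.diagonal fun j => (d j : ℂ)).IsHermitian :=
    Matrix.isHermitian_diagonal_of_self_adjoint _ (by ext; simp)
  rw [entropy_eq_sum_roots h, Matrix.charpoly_diagonal, Polynomial.roots_prod _ _
    (Finset.prod_ne_zero_iff.mpr fun j _ => Polynomial.X_sub_C_ne_zero _)]
  simp [Polynomial.roots_X_sub_C, Multiset.bind_singleton]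

theorem entropy_unitary_conj (U : Matrix.unitaryGroup ι ℂ) {ρ : Matrix ι ι ℂ}
    (h : ρ.IsHermitian) : entropy ((U : Matrix ι ι ℂ) * ρ * (U : Matrix ι ι ℂ)ᴴ) = entropy ρ := by
  have hU : (U : Matrix ι ι ℂ)ᴴ * (U : Matrix ι ι ℂ) = 1 := Unitary.coe_star_mul_self U
  have hρ : ρ * (U : Matrix ι ι ℂ)ᴴ * (U : Matrix ι ι ℂ) = ρ := by
    rw [Matrix.mul_assoc, hU, Matrix.mul_one]
  rw [Matrix.mul_assoc, entropy_mul_comm, hρ]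
  · rw [← Matrix.mul_assoc]
    exact Matrix.isHermitian_mul_mul_conjTranspose _ h
  · rwa [hρ]

theorem eq_conj_diagonal_eigenvalues {ρ : Matrix ι ι ℂ} (h : ρ.IsHermitian) :
    ρ = (h.eigenvectorUnitary : Matrix ι ι ℂ) * Matrix.diagonal (fun j => (h.eigenvalues j : ℂ)) *
      (h.eigenvectorUnitary : Matrix ι ι ℂ)ᴴ :=
  h.spectral_theorem

theorem entropy_smul (p : ℝ) {ρ : Matrix ι ι ℂ} (h : ρ.IsHermitian) :
    entropy ((p : ℂ) • ρ) =
      Real.negMulLog p / Real.log 2 * ρ.trace.re + p * entropy ρ := by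
  have hp : (p : ℂ) • ρ = (h.eigenvectorUnitary : Matrix ι ι ℂ) *
      Matrix.diagonal (fun j => ((p * h.eigenvalues j : ℝ) : ℂ)) *
      (h.eigenvectorUnitary : Matrix ι ι ℂ)ᴴ := by
    conv_lhs => rw [eq_conj_diagonal_eigenvalues h]
    rw [← Matrix.smul_mul, ← Matrix.mul_smul, ← Matrix.diagonal_smul]
    simp [Pi.smul_def]
  have hd : (Matrix.diagonal fun j => ((p * h.eigenvalues j : ℝ) : ℂ)).IsHermitian :=
    Matrix.isHermitian_diagonal_of_self_adjoint _ (by ext; simp)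
  rw [hp, entropy_unitary_conj _ hd, entropy_diagonal, entropy_eq_sum_eigenvalues h,
    h.trace_eq_sum_eigenvalues]
  simp only [Real.negMulLog_mul, Finset.sum_add_distrib, ← Finset.sum_mul, ← Finset.mul_sum]
  simp
  ring

theorem entropy_mul_log_two_le_sum_negMulLog_diag {ρ : Matrix ι ι ℂ} (h : ρ.PosSemidef) :
    entropy ρ * Real.log 2 ≤ ∑ i, Real.negMulLog (ρ i i).re := by
  have diag : ∀ i, (ρ i i).re = (Matrix.of (fun i j => Complex.normSq (h.1.eigenvectorUnitary i j))
      *ᵥ h.1.eigenvalues) i := by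
    intro i
    apply Complex.ofReal_injective
    rw [show ((ρ i i).re : ℂ) = ρ i i from h.1.coe_re_apply_self i]
    conv_lhs => rw [eq_conj_diagonal_eigenvalues h.1]
    rw [Matrix.mul_apply]
    simp only [Matrix.mul_diagonal, Matrix.conjTranspose_apply, Matrix.mulVec,
      dotProduct, Matrix.of_apply, Complex.ofReal_sum, Complex.ofReal_mul, ← Complex.mul_conj]
    exact Finset.sum_congr rfl fun j _ => mul_right_comm _ _ _
  rw [entropy_eq_sum_eigenvalues h.1, div_mul_cancel₀ _ (Real.log_pos one_lt_two).ne']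
  simp only [diag]
  exact sum_map_le_sum_map_mulVec_of_mem_doublyStochastic Real.concaveOn_negMulLog
    (normSq_mem_doublyStochastic _) h.eigenvalues_nonneg

theorem entropy_le_of_reducedState_diag [DecidableEq τ] {ρ : Matrix (κ × τ) (κ × τ) ℂ}
    (h : ρ.PosSemidef) {w : κ → ℝ} (hw : ∀ a, (reducedState (Equiv.refl _) ρ a a).re = w a) :
    entropy ρ * Real.log 2 ≤
      ∑ a, Real.negMulLog (w a) + (∑ a, w a) * Real.log (Fintype.card τ) := by
  refine (entropy_mul_log_two_le_sum_negMulLog_diag h).trans ?_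
  rw [Fintype.sum_prod_type, Finset.sum_mul, ← Finset.sum_add_distrib]
  refine Finset.sum_le_sum fun a _ => ?_
  rw [← hw a]
  simpa [reducedState] using
    sum_negMulLog_le fun t => (Complex.nonneg_iff.mp (h.diag_nonneg (i := (a, t)))).1

-- After diagonalizing the reduced state by a unitary of `κ` alone, only the diagonal matters: a
-- measurement in the computational basis cannot decrease the entropy.
theorem entropy_le_entropy_reducedState_add (e : ι ≃ κ × τ) {ρ : Matrix ι ι ℂ}
    (h : ρ.PosSemidef) :
    entropy ρ ≤ entropy (reducedState e ρ) + ρ.trace.re * Real.logb 2 (Fintype.card τ) := by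
  classical
  have hσ := (reducedState_posSemidef e h).1
  set V := star hσ.eigenvectorUnitary
  let W : Matrix.unitaryGroup (κ × τ) ℂ :=
    ⟨(V : Matrix κ κ ℂ) ⊗ₖ (1 : Matrix τ τ ℂ), Matrix.kronecker_mem_unitary V.2 (one_mem _)⟩
  let ρ' := (W : Matrix (κ × τ) (κ × τ) ℂ) * Matrix.reindex e e ρ *
    (W : Matrix (κ × τ) (κ × τ) ℂ)ᴴ
  have pos : ρ'.PosSemidef := (h.submatrix e.symm).mul_mul_conjTranspose_same _
  have diagonalized : reducedState (Equiv.refl _) ρ' =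
      Matrix.diagonal fun a => (hσ.eigenvalues a : ℂ) :=
    (reducedState_conj_kronecker_one _ _).trans hσ.conjStarAlgAut_star_eigenvectorUnitary
  have key := entropy_le_of_reducedState_diag pos (w := hσ.eigenvalues) fun a => by
    simp [diagonalized]
  have entropy_eq : entropy ρ' = entropy ρ :=
    (entropy_unitary_conj W (h.1.submatrix e.symm)).trans (entropy_reindex e h.1)
  have sum_eigenvalues : ∑ a, hσ.eigenvalues a = ρ.trace.re := by
    rw [← trace_reducedState e, hσ.trace_eq_sum_eigenvalues]
    simp
  rw [entropy_eq, sum_eigenvalues, ← le_div_iff₀ (Real.log_pos one_lt_two), add_div,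
    mul_div_assoc] at key
  rwa [entropy_eq_sum_eigenvalues hσ]

theorem entropy_reducedState_le (e : ι ≃ κ × τ) {ρ : Matrix ι ι ℂ} (h : ρ.PosSemidef) :
    entropy (reducedState e ρ) ≤ entropy ρ + ρ.trace.re * Real.logb 2 (Fintype.card τ) := by
  classical
  obtain ⟨B, hB⟩ : ∃ B : Matrix ι ι ℂ, ρ = Bᴴ * B := by
    open scoped MatrixOrder Matrix.Norms.L2Operator in
    exact CStarAlgebra.nonneg_iff_eq_star_mul_self.mp h.nonneg
  -- `C * Cᴴ` has the spectrum of the reduced state and extends `B * Bᴴ`, which has the spectrum of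
  -- `ρ`. It plays the part of the complementary state in a purification of `ρ`.
  let C : Matrix (ι × τ) κ ℂ := Matrix.of fun k a => B k.1 (e.symm (a, k.2))
  have hC : reducedState e ρ = Cᴴ * C := by
    ext a a'
    simp only [reducedState, hB, C, Matrix.of_apply, Matrix.mul_apply, Matrix.conjTranspose_apply]
    rw [Fintype.sum_prod_type, Finset.sum_comm]
  have hB' : reducedState (Equiv.refl _) (C * Cᴴ) = B * Bᴴ := by
    ext k k'
    simp only [reducedState, C, Matrix.of_apply, Matrix.mul_apply, Matrix.conjTranspose_apply]
    rw [Finset.sum_comm, ← Fintype.sum_prod_type', ← e.sum_comp]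
    simp
  have key := entropy_le_entropy_reducedState_add (Equiv.refl _)
    (Matrix.posSemidef_self_mul_conjTranspose C)
  have htr : (C * Cᴴ).trace = ρ.trace := by
    rw [Matrix.trace_mul_comm, ← hC, trace_reducedState]
  rwa [hB', htr, entropy_mul_comm (Matrix.isHermitian_mul_conjTranspose_self _)
    (Matrix.isHermitian_conjTranspose_mul_self _), ← hC,
    entropy_mul_comm (A := B) (Matrix.isHermitian_mul_conjTranspose_self _)
    (Matrix.isHermitian_conjTranspose_mul_self _), ← hB] at key

end Entropy

/-! ### Conditional mutual information -/

section CondMutualInfo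

variable {P Q R C S ι κ γ : Type} [Fintype P] [DecidableEq P] [Fintype Q] [DecidableEq Q]
  [Fintype R] [DecidableEq R] [Fintype C] [DecidableEq C] [Fintype S] [DecidableEq S]
  [Fintype ι] [DecidableEq ι] [Fintype κ] [DecidableEq κ] [Fintype γ] [DecidableEq γ]

/-- Regroups three parties `P`, `Q`, `R` so that tracing out the second factor leaves `P × R`. -/
def isolateOuter (P Q R : Type) : P × Q × R ≃ (P × R) × Q :=
  ⟨fun s => ((s.1, s.2.2), s.2.1), fun s => (s.1.1, s.2, s.1.2), fun _ => rfl, fun _ => rfl⟩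

/-- Regroups three parties `P`, `Q`, `R` so that tracing out the second factor leaves `R`. -/
def isolateLast (P Q R : Type) : P × Q × R ≃ R × (P × Q) :=
  ⟨fun s => (s.2.2, (s.1, s.2.1)), fun s => (s.2.1, s.2.2, s.1), fun _ => rfl, fun _ => rfl⟩

theorem condMutualInfo_eq (ρ : Matrix (P × Q × R) (P × Q × R) ℂ) :
    condMutualInfo ρ =
      entropy (reducedState (isolateOuter P Q R) ρ) +
        entropy (reducedState (Equiv.prodComm P (Q × R)) ρ) -
        entropy (reducedState (isolateLast P Q R) ρ) - entropy ρ :=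
  rfl

theorem condMutualInfo_le {ρ : Matrix (P × Q × R) (P × Q × R) ℂ} (h : ρ.PosSemidef) :
    condMutualInfo ρ ≤ 2 * (ρ.trace.re * Real.logb 2 (Fintype.card P)) := by
  have traced_twice : reducedState (Equiv.prodComm P R) (reducedState (isolateOuter P Q R) ρ) =
      reducedState (isolateLast P Q R) ρ := by
    ext r r'
    exact (Fintype.sum_prod_type' _).symm
  have hPR := entropy_le_entropy_reducedState_add (Equiv.prodComm P R)
    (reducedState_posSemidef (isolateOuter P Q R) h)
  have hQR := entropy_reducedState_le (Equiv.prodComm P (Q × R)) h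
  rw [traced_twice, trace_reducedState] at hPR
  rw [condMutualInfo_eq]
  linarith

theorem charpoly_blockDiagonal (M : γ → Matrix κ κ ℂ) :
    (Matrix.blockDiagonal M).charpoly = ∏ c, (M c).charpoly := by
  have : (Matrix.blockDiagonal M).charmatrix = Matrix.blockDiagonal fun c => (M c).charmatrix := by
    ext ⟨a, c⟩ ⟨a', c'⟩ : 1
    by_cases hc : c = c'
    · subst hc
      by_cases ha : a = a' <;>
        simp [Matrix.blockDiagonal_apply, ha]
    · simp [Matrix.blockDiagonal_apply, hc]
  rw [Matrix.charpoly, this, Matrix.det_blockDiagonal]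
  rfl

theorem entropy_blockDiagonal {M : γ → Matrix κ κ ℂ} (h : ∀ c, (M c).IsHermitian) :
    entropy (Matrix.blockDiagonal M) = ∑ c, entropy (M c) := by
  have hM : (Matrix.blockDiagonal M).IsHermitian := by
    rw [Matrix.IsHermitian, Matrix.blockDiagonal_conjTranspose]
    exact congrArg _ (funext h)
  rw [entropy_eq_sum_roots hM, charpoly_blockDiagonal, Polynomial.roots_prod]
  · rw [Multiset.map_bind, Multiset.sum_bind]
    simp only [fun c => entropy_eq_sum_roots (h c), ← Finset.sum_div]
    rfl
  · exact Finset.prod_ne_zero_iff.mpr fun c _ => (Matrix.charpoly_monic _).ne_zero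

theorem entropy_classicalQuantum (e : ι ≃ κ × γ) (p : γ → ℝ) {σ : γ → Matrix κ κ ℂ}
    (hσ : ∀ c, (σ c).IsHermitian) {ρ : Matrix ι ι ℂ}
    (hρ : ∀ s t, ρ s t =
      if (e s).2 = (e t).2 then (p (e s).2 : ℂ) * σ (e s).2 (e s).1 (e t).1 else 0) :
    entropy ρ =
      ∑ c, (Real.negMulLog (p c) / Real.log 2 * (σ c).trace.re + p c * entropy (σ c)) := by
  have hblock : ∀ c, ((p c : ℂ) • σ c).IsHermitian := fun c => by
    simp [Matrix.IsHermitian, Matrix.conjTranspose_smul, (hσ c).eq]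
  have hD : (Matrix.blockDiagonal fun c => (p c : ℂ) • σ c).IsHermitian := by
    rw [Matrix.IsHermitian, Matrix.blockDiagonal_conjTranspose]
    exact congrArg _ (funext hblock)
  have : ρ = Matrix.reindex e.symm e.symm (Matrix.blockDiagonal fun c => (p c : ℂ) • σ c) := by
    ext s t
    simp [hρ, Matrix.blockDiagonal_apply]
  rw [this, entropy_reindex _ hD, entropy_blockDiagonal hblock]
  exact Finset.sum_congr rfl fun c _ => entropy_smul _ (hσ c)

theorem condMutualInfo_eq_zero (p : Q × C → ℝ) {σ : C → Matrix (P × S) (P × S) ℂ}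
    (hσ : ∀ c, (σ c).IsHermitian) {ρ : Matrix (P × Q × (C × S)) (P × Q × (C × S)) ℂ}
    (hρ : ∀ a q c s a' q' c' s', ρ (a, q, c, s) (a', q', c', s') =
      if q = q' ∧ c = c' then (p (q, c) : ℂ) * σ c (a, s) (a', s') else 0) :
    condMutualInfo ρ = 0 := by
  let pC : C → ℝ := fun c => ∑ q, p (q, c)
  let σS : C → Matrix S S ℂ := fun c => reducedState (Equiv.prodComm P S) (σ c)
  have hσS : ∀ c, (σS c).IsHermitian := fun c => reducedState_isHermitian _ (hσ c)
  have hPQR := entropy_classicalQuantum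
    (((Equiv.refl P).prodCongr (Equiv.prodAssoc Q C S).symm).trans (isolateOuter P (Q × C) S))
    p (fun c => hσ c.2) (ρ := ρ) fun ⟨a, q, c, s⟩ ⟨a', q', c', s'⟩ => by
      simp [hρ, isolateOuter]
  have hQR := entropy_classicalQuantum
    ((Equiv.prodAssoc Q C S).symm.trans (Equiv.prodComm (Q × C) S))
    p (fun c => hσS c.2) (ρ := reducedState (Equiv.prodComm P (Q × (C × S))) ρ)
    fun ⟨q, c, s⟩ ⟨q', c', s'⟩ => by
      by_cases h : q = q' ∧ c = c' <;> simp [reducedState, hρ, σS, h, Finset.mul_sum]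
  have hPR := entropy_classicalQuantum (isolateOuter P C S)
    pC hσ (ρ := reducedState (isolateOuter P Q (C × S)) ρ)
    fun ⟨a, c, s⟩ ⟨a', c', s'⟩ => by
      by_cases h : c = c' <;> simp [reducedState, isolateOuter, hρ, pC, h, Finset.sum_mul]
  have hR := entropy_classicalQuantum (Equiv.prodComm C S)
    pC hσS (ρ := reducedState (isolateLast P Q (C × S)) ρ)
    fun ⟨c, s⟩ ⟨c', s'⟩ => by
      by_cases h : c = c' <;> simp [reducedState, isolateLast, hρ, σS, pC, h, Finset.sum_mul,
        Finset.mul_sum, Fintype.sum_prod_type]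
  have htr : ∀ c, (σS c).trace = (σ c).trace := fun c => trace_reducedState _ _
  rw [condMutualInfo_eq, hPQR, hQR, hPR, hR]
  simp only [htr, Fintype.sum_prod_type_right, Finset.sum_add_distrib, ← Finset.sum_mul, pC]
  ring

end CondMutualInfo

/-! ### Privacy loss -/

theorem sum_normSq_unitary_mulVec {ι : Type} [Fintype ι] [DecidableEq ι]
    (U : Matrix.unitaryGroup ι ℂ) (v : ι → ℂ) :
    ∑ i, ‖((U : Matrix ι ι ℂ) *ᵥ v) i‖ ^ 2 = ∑ i, ‖v i‖ ^ 2 := by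
  have normSq : ∀ w : ι → ℂ, ((∑ i, ‖w i‖ ^ 2 : ℝ) : ℂ) = star w ⬝ᵥ w := fun w => by
    simp [dotProduct, Complex.conj_mul']
  rw [← Complex.ofReal_inj, normSq, normSq, Matrix.star_mulVec, Matrix.dotProduct_mulVec,
    Matrix.vecMul_vecMul, ← Matrix.star_eq_conjTranspose, Matrix.UnitaryGroup.star_mul_self,
    Matrix.vecMul_one]

namespace Protocol

variable {X Y Z : Type}

theorem applyAlice_one (π : Protocol X Y Z) (φ : π.Ket) : π.applyAlice 1 φ = φ := by
  ext s
  simp [applyAlice]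

theorem sum_normSq_applyAlice (π : Protocol X Y Z) (U : Matrix.unitaryGroup (π.RegA × π.RegM) ℂ)
    (φ : π.Ket) : ∑ s, ‖π.applyAlice U φ s‖ ^ 2 = ∑ s, ‖φ s‖ ^ 2 := by
  have split : ∀ ψ : π.Ket, ∑ s, ‖ψ s‖ ^ 2 =
      ∑ b, ∑ r : π.RegA × π.RegM, ‖ψ (r.1, r.2, b)‖ ^ 2 := fun ψ => by
    simp only [Fintype.sum_prod_type]
    rw [Finset.sum_comm (γ := π.RegB)]
    exact Finset.sum_congr rfl fun a _ => Finset.sum_comm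
  rw [split, split]
  exact Finset.sum_congr rfl fun b _ => sum_normSq_unitary_mulVec U fun r => φ (r.1, r.2, b)

theorem sum_normSq_applyBob (π : Protocol X Y Z) (V : Matrix.unitaryGroup (π.RegM × π.RegB) ℂ)
    (φ : π.Ket) : ∑ s, ‖π.applyBob V φ s‖ ^ 2 = ∑ s, ‖φ s‖ ^ 2 := by
  rw [Fintype.sum_prod_type, Fintype.sum_prod_type]
  exact Finset.sum_congr rfl fun a _ => sum_normSq_unitary_mulVec V fun r => φ (a, r)

theorem sum_normSq_state (π : Protocol X Y Z) (x : X) (y : Y) (k : ℕ) :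
    ∑ s, ‖π.state x y k s‖ ^ 2 = 1 := by
  induction k with
  | zero =>
    simp [state, Pi.single_apply, apply_ite (fun c : ℂ => ‖c‖ ^ 2)]
  | succ k ih =>
    rw [state]
    split_ifs
    · rw [sum_normSq_applyAlice, ih]
    · rw [sum_normSq_applyBob, ih]

theorem outputProb_eq_one [DecidableEq Z] (π : Protocol X Y Z) {x : X} {y : Y} {z : Z}
    (h : ∀ s, π.applyAlice (π.aliceFinal x) (π.state x y π.rounds) s ≠ 0 →
      π.output x (s.1, s.2.1) = z) : π.outputProb x y z = 1 := by
  rw [outputProb, ← π.sum_normSq_state x y π.rounds, ← π.sum_normSq_applyAlice (π.aliceFinal x)]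
  refine Finset.sum_congr rfl fun s _ => ?_
  split_ifs with hs
  · rfl
  · simp [not_imp_comm.mp (h s) hs]

/-- The reduced state of the message register and Bob's workspace at round `k` on inputs `x`, `y`.
In an odd round it contains all the quantum information that Bob has access to. -/
noncomputable def bobState (π : Protocol X Y Z) (x : X) (y : Y) (k : ℕ) :
    Matrix (π.RegM × π.RegB) (π.RegM × π.RegB) ℂ :=
  reducedState (Equiv.prodComm _ _) (Matrix.vecMulVec (π.state x y k) (star (π.state x y k)))

theorem bobState_posSemidef (π : Protocol X Y Z) (x : X) (y : Y) (k : ℕ) :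
    (π.bobState x y k).PosSemidef :=
  reducedState_posSemidef _ (Matrix.posSemidef_vecMulVec_self_star _)

section Loss

variable [DecidableEq X] [DecidableEq Y]

theorem jointState_posSemidef [Finite X] [Finite Y] (π : Protocol X Y Z) {μ : X × Y → ℝ}
    (hμ : 0 ≤ μ) (k : ℕ) : (π.jointState μ k).PosSemidef := by
  cases nonempty_fintype X
  cases nonempty_fintype Y
  let v : X × Y → X × Y × π.RegA × π.RegM × π.RegB → ℂ := fun p s =>
    if s.1 = p.1 ∧ s.2.1 = p.2 then π.state p.1 p.2 k s.2.2 else 0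
  have mixture : π.jointState μ k = ∑ p, (μ p : ℂ) • Matrix.vecMulVec (v p) (star (v p)) := by
    ext ⟨x, y, s⟩ ⟨x', y', t⟩
    simp only [jointState, Matrix.of_apply, Matrix.sum_apply, Matrix.smul_apply,
      Matrix.vecMulVec_apply, Pi.star_apply, smul_eq_mul]
    rw [Fintype.sum_eq_single (x, y)]
    · by_cases h : x = x' ∧ y = y'
      · obtain ⟨rfl, rfl⟩ := h
        simp [v, mul_assoc]
      · have h' : ¬ (x' = x ∧ y' = y) := fun h' => h ⟨h'.1.symm, h'.2.symm⟩
        simp [v, h, h']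
    · intro p hp
      have : ¬ (x = p.1 ∧ y = p.2) := fun h => hp (Prod.ext h.1.symm h.2.symm)
      simp [v, this]
  rw [mixture]
  refine Matrix.posSemidef_sum _ fun p _ => (Matrix.posSemidef_vecMulVec_self_star _).smul ?_
  exact_mod_cast hμ p

variable [Fintype X] [Fintype Y]

theorem jointState_trace (π : Protocol X Y Z) (μ : X × Y → ℝ) (k : ℕ) :
    (π.jointState μ k).trace = ∑ p, (μ p : ℂ) := by
  have h : ∀ x y, ∑ s, (μ (x, y) : ℂ) * π.state x y k s * star (π.state x y k s) = μ (x, y) := by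
    intro x y
    simp only [mul_assoc, ← Finset.mul_sum, Complex.star_def, Complex.mul_conj']
    have := congrArg (fun r : ℝ => (r : ℂ)) (π.sum_normSq_state x y k)
    push_cast at this
    rw [this, mul_one]
  rw [Matrix.trace, Fintype.sum_prod_type, Fintype.sum_prod_type]
  simp only [Fintype.sum_prod_type (α₁ := Y), Matrix.diag, jointState, Matrix.of_apply, and_self,
    if_true, h]

theorem lossB_le_communication (π : Protocol X Y Z) {μ : X × Y → ℝ}
    (hμ : μ ∈ stdSimplex ℝ (X × Y)) : π.lossB μ ≤ π.communication := by
  have round_le : ∀ k ∈ (Finset.Icc 1 π.rounds).filter (fun k => Even k), _ ≤ _ := fun k _ =>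
    condMutualInfo_le (reducedState_posSemidef
      (⟨fun s => ((s.2.2.2.1, s.2.1, (s.1, s.2.2.1)), s.2.2.2.2),
        fun s => (s.1.2.2.1, s.1.2.1, s.1.2.2.2, s.1.1, s.2),
        fun _ => rfl, fun _ => rfl⟩ :
        X × Y × π.RegA × π.RegM × π.RegB ≃ (π.RegM × Y × (X × π.RegA)) × π.RegB)
      (π.jointState_posSemidef hμ.1 k))
  have trace_eq_one : ∀ k, (π.jointState μ k).trace = 1 := fun k => by
    rw [jointState_trace]
    exact_mod_cast hμ.2
  have logb_card : Real.logb 2 (Fintype.card π.RegM) = π.qubitsM := by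
    simp [Real.logb_pow]
  have even_rounds : ((Finset.Icc 1 π.rounds).filter (fun k => Even k)).card * 2 = π.rounds := by
    have := Nat.Ioc_filter_dvd_card_eq_div π.rounds 2
    simp only [← even_iff_two_dvd] at this
    rw [← Finset.Icc_add_one_left_eq_Ioc, zero_add] at this
    rw [this, Nat.div_mul_cancel π.rounds_even.two_dvd]
  refine (Finset.sum_le_sum round_le).trans (le_of_eq ?_)
  simp only [trace_reducedState, trace_eq_one, logb_card, Complex.one_re, one_mul,
    Finset.sum_const, nsmul_eq_mul, communication]
  rw [← mul_assoc]
  exact_mod_cast congrArg (· * π.qubitsM) even_rounds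

theorem lossA_eq_zero (π : Protocol X Y Z)
    (h : ∀ k ≤ π.rounds, Odd k → ∀ x x' y, π.bobState x y k = π.bobState x' y k)
    (μ : X × Y → ℝ) : π.lossA μ = 0 := by
  refine Finset.sum_eq_zero fun k hk => ?_
  simp only [Finset.mem_filter, Finset.mem_Icc] at hk
  obtain hX | ⟨⟨x₀⟩⟩ := isEmpty_or_nonempty X
  · exact condMutualInfo_eq_zero μ (fun _ => Matrix.isHermitian_zero) fun _ q => hX.elim q
  · refine condMutualInfo_eq_zero μ (fun y => (π.bobState_posSemidef x₀ y k).1) ?_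
    intro w x y b w' x' y' b'
    rw [h k hk.1.2 hk.2 x₀ x y]
    by_cases hxy : x = x' ∧ y = y' <;>
      simp [reducedState, bobState, jointState, Matrix.vecMulVec_apply, hxy, mul_assoc,
        Finset.mul_sum]

end Loss

end Protocol

/-! ### Queries in superposition -/

section Unitaries

variable {ι : Type} [Fintype ι] [DecidableEq ι]

/-- The unitary that maps the basis vector `s` to the basis vector `σ s`. -/
noncomputable def permUnitary (σ : Equiv.Perm ι) : Matrix.unitaryGroup ι ℂ :=
  ⟨σ⁻¹.permMatrix ℂ, by
    rw [Matrix.mem_unitaryGroup_iff, Matrix.star_eq_conjTranspose, Matrix.conjTranspose_permMatrix,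
      ← Matrix.permMatrix_mul, inv_inv, mul_inv_cancel, Matrix.permMatrix_one]⟩

theorem permUnitary_mulVec (σ : Equiv.Perm ι) (v : ι → ℂ) :
    (permUnitary σ : Matrix ι ι ℂ) *ᵥ v = v ∘ σ.symm :=
  Matrix.permMatrix_mulVec _

theorem exists_unitary_mulVec_single (i : ι) {v : ι → ℂ} (hv : ∑ j, ‖v j‖ ^ 2 = 1) :
    ∃ U : Matrix.unitaryGroup ι ℂ, (U : Matrix ι ι ℂ) *ᵥ Pi.single i 1 = v := by
  have norm_eq_one : ‖WithLp.toLp 2 v‖ = 1 := by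
    rw [EuclideanSpace.norm_eq, Real.sqrt_eq_one]
    exact hv
  have orthonormal : Orthonormal ℂ (({i} : Set ι).domRestrict fun _ => WithLp.toLp 2 v) :=
    ⟨fun _ => norm_eq_one, fun a b hab => (hab (Subsingleton.elim a b)).elim⟩
  obtain ⟨b, hb⟩ := orthonormal.exists_orthonormalBasis_extension_of_card_eq (by simp)
  refine ⟨⟨(EuclideanSpace.basisFun ι ℂ).toBasis.toMatrix b,
    (EuclideanSpace.basisFun ι ℂ).toMatrix_orthonormalBasis_mem_unitary b⟩, ?_⟩
  ext j
  simp [Module.Basis.toMatrix_apply, hb i rfl]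

/-- A unitary that prepares the unit vector `v` from the basis vector `i`. -/
noncomputable def prepUnitary (i : ι) {v : ι → ℂ} (hv : ∑ j, ‖v j‖ ^ 2 = 1) :
    Matrix.unitaryGroup ι ℂ :=
  (exists_unitary_mulVec_single i hv).choose

theorem prepUnitary_mulVec (i : ι) {v : ι → ℂ} (hv : ∑ j, ‖v j‖ ^ 2 = 1) :
    (prepUnitary i hv : Matrix ι ι ℂ) *ᵥ Pi.single i 1 = v :=
  (exists_unitary_mulVec_single i hv).choose_spec

end Unitaries

section GraphKet

variable {C W : Type} [Fintype C] [DecidableEq W]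

/-- The uniform superposition of the basis vectors `(c, g c)`: a control register `C` holds a
uniformly random `c` and a second register `W` holds `g c`. -/
noncomputable def graphKet (g : C → W) : C × W → ℂ :=
  fun s => if g s.1 = s.2 then (√(Fintype.card C) : ℂ)⁻¹ else 0

theorem apply_eq_of_graphKet_ne_zero {g : C → W} {s : C × W} (h : graphKet g s ≠ 0) :
    g s.1 = s.2 := by
  by_contra hs
  exact h (if_neg hs)

theorem sum_normSq_graphKet [Fintype W] [Nonempty C] (g : C → W) :
    ∑ s, ‖graphKet g s‖ ^ 2 = 1 := by
  simp [graphKet, Fintype.sum_prod_type, apply_ite (fun c : ℂ => ‖c‖ ^ 2)]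

theorem permUnitary_prodShear_mulVec_graphKet [DecidableEq C] [Fintype W]
    (σ : C → Equiv.Perm W) (g : C → W) :
    (permUnitary ((Equiv.refl C).prodShear σ) : Matrix (C × W) (C × W) ℂ) *ᵥ graphKet g =
      graphKet fun c => σ c (g c) := by
  ext ⟨c, w⟩
  simp [permUnitary_mulVec, graphKet, Equiv.eq_symm_apply]

theorem sum_graphKet_mul_star {g : C → W} (hg : Function.Bijective g) (w w' : W) :
    ∑ c, graphKet g (c, w) * star (graphKet g (c, w')) =
      if w = w' then (Fintype.card C : ℂ)⁻¹ else 0 := by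
  have sqrt_mul_self : (√(Fintype.card C) : ℂ) * √(Fintype.card C) = Fintype.card C := by
    exact_mod_cast Real.mul_self_sqrt (Nat.cast_nonneg _)
  obtain ⟨c₀, rfl⟩ := hg.2 w
  rw [Fintype.sum_eq_single c₀]
  · by_cases h : g c₀ = w' <;> simp [graphKet, h, ← mul_inv, sqrt_mul_self]
  · intro c hc
    simp [graphKet, hg.1.ne hc]

end GraphKet

namespace Protocol

variable {X Y Z : Type}

/-- The vector of amplitudes with registers `A` and `M` in the superposition `graphKet g`. It does
not depend on the basis vector of `B`, so it is a unit vector only if `B` has no qubits. -/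
noncomputable def graphState (π : Protocol X Y Z) (g : π.RegA → π.RegM) : π.Ket :=
  fun s => graphKet g (s.1, s.2.1)

theorem applyAlice_prepUnitary_state_zero (π : Protocol X Y Z) [Subsingleton π.RegB] (x : X)
    (y : Y) (g : π.RegA → π.RegM) :
    π.applyAlice (prepUnitary (fun _ => false, fun _ => false) (sum_normSq_graphKet g))
      (π.state x y 0) = π.graphState g := by
  have init : ∀ b, (fun r : π.RegA × π.RegM => π.state x y 0 (r.1, r.2, b)) =
      Pi.single (fun _ => false, fun _ => false) 1 := fun b => by
    ext r
    obtain rfl : b = fun _ => false := Subsingleton.elim _ _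
    simp [state, Pi.single_apply, Prod.ext_iff]
  ext ⟨a, w, b⟩
  rw [applyAlice, init, prepUnitary_mulVec, graphState]

theorem applyAlice_permUnitary_graphState (π : Protocol X Y Z) (σ : π.RegA → Equiv.Perm π.RegM)
    (g : π.RegA → π.RegM) :
    π.applyAlice (permUnitary ((Equiv.refl _).prodShear σ)) (π.graphState g) =
      π.graphState fun a => σ a (g a) :=
  funext fun s => congrFun (permUnitary_prodShear_mulVec_graphKet σ g) (s.1, s.2.1)

theorem applyBob_permUnitary_graphState (π : Protocol X Y Z) (τ : Equiv.Perm π.RegM)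
    (g : π.RegA → π.RegM) :
    π.applyBob (permUnitary (τ.prodCongr (Equiv.refl _))) (π.graphState g) =
      π.graphState (τ ∘ g) := by
  ext s
  simp [applyBob, permUnitary_mulVec, graphState, graphKet, Equiv.eq_symm_apply]

theorem bobState_of_graphState (π : Protocol X Y Z) {x : X} {y : Y} {k : ℕ}
    {g : π.RegA → π.RegM} (hg : Function.Bijective g) (h : π.state x y k = π.graphState g) :
    π.bobState x y k =
      Matrix.of fun s t => if s.1 = t.1 then (Fintype.card π.RegA : ℂ)⁻¹ else 0 := by
  ext s t
  rw [bobState, h]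
  exact sum_graphKet_mul_star hg s.1 t.1

end Protocol

section MaskedMessage

variable {Q V : Type} [AddCommGroup V] {d : ℕ}

/-- The message that consists of the query `q r` and of the running sum `v r` of the answers masked
by `t`, where `(r, t)` is Alice's private randomness. Both pairs are encoded into bits by `e`. -/
def maskedMessage (e : Bits d ≃ Q × V) (q : Q → Q) (v : Q → V) (c : Bits d) : Bits d :=
  e.symm (q (e c).1, (e c).2 + v (e c).1)

theorem maskedMessage_bijective (e : Bits d ≃ Q × V) {q : Q → Q} (hq : Function.Bijective q)
    (v : Q → V) : Function.Bijective (maskedMessage e q v) :=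
  (e.trans (((Equiv.refl Q).prodShear fun r => Equiv.addRight (v r)).trans
    (((Equiv.ofBijective q hq).prodCongr (Equiv.refl V)).trans e.symm))).bijective

/-- The permutation by which Alice replaces the query `q r` by `q' r` in a masked message, when her
workspace contains the encoding of `(r, t)`. -/
def requery [DecidableEq Q] (e : Bits d ≃ Q × V) (q q' : Q → Q) (c : Bits d) :
    Equiv.Perm (Bits d) :=
  e.symm.permCongr ((Equiv.swap (q (e c).1) (q' (e c).1)).prodCongr (Equiv.refl V))

theorem requery_maskedMessage [DecidableEq Q] (e : Bits d ≃ Q × V) (q q' : Q → Q) (v : Q → V)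
    (c : Bits d) : requery e q q' c (maskedMessage e q v c) = maskedMessage e q' v c := by
  simp [requery, maskedMessage, Equiv.permCongr_apply]

/-- The permutation by which Bob adds his answer to the query to the running sum. -/
def addAnswer (e : Bits d ≃ Q × V) (answer : Q → V) : Equiv.Perm (Bits d) :=
  e.symm.permCongr ((Equiv.refl Q).prodShear fun q => Equiv.addRight (answer q))

theorem addAnswer_comp_maskedMessage (e : Bits d ≃ Q × V) (answer : Q → V) (q : Q → Q)
    (v : Q → V) :
    addAnswer e answer ∘ maskedMessage e q v =
      maskedMessage e q fun r => v r + answer (q r) := by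
  ext c : 1
  simp [addAnswer, maskedMessage, Equiv.permCongr_apply, add_assoc]

end MaskedMessage

section QueryProtocol

variable {X Y Z Q V : Type} [DecidableEq Q] [AddCommGroup V] {d : ℕ}

/-- The protocol in which Alice asks the queries `query x 0 r, …, query x (N - 1) r`, where `r` is
held in uniform superposition, and computes her output from the sum of Bob's answers. The message
register contains the current query and the sum of the answers so far, masked by a value which is
also held in uniform superposition in Alice's workspace. -/
noncomputable abbrev queryProtocol (N : ℕ) (e : Bits d ≃ Q × V) (query : X → ℕ → Q → Q)
    (answer : Y → Q → V) (out : V → Z) : Protocol X Y Z where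
  qubitsA := d
  qubitsM := d
  qubitsB := 0
  rounds := 2 * N
  rounds_even := even_two_mul N
  aliceOp k x :=
    if k = 1 then
      prepUnitary (fun _ => false, fun _ => false)
        (sum_normSq_graphKet (maskedMessage e (query x 0) 0))
    else permUnitary ((Equiv.refl _).prodShear (requery e (query x (k / 2 - 1)) (query x (k / 2))))
  bobOp _ y := permUnitary ((addAnswer e (answer y)).prodCongr (Equiv.refl _))
  aliceFinal _ := 1
  output _ s := out ((e s.2).2 - (e s.1).2)

variable {N : ℕ} (e : Bits d ≃ Q × V) {query : X → ℕ → Q → Q} {answer : Y → Q → V} {out : V → Z}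

theorem queryProtocol_state_even {x : X} {y : Y} {j : ℕ} {v : Q → V}
    (h : (queryProtocol N e query answer out).state x y (2 * j + 1) =
      (queryProtocol N e query answer out).graphState (maskedMessage e (query x j) v)) :
    (queryProtocol N e query answer out).state x y (2 * (j + 1)) =
      (queryProtocol N e query answer out).graphState
        (maskedMessage e (query x j) fun r => v r + answer y (query x j r)) := by
  have not_odd : ¬ Odd (2 * j + 1 + 1) :=
    Nat.not_odd_iff_even.mpr (odd_two_mul_add_one j).add_one
  rw [mul_add_one, Protocol.state, if_neg not_odd, h, ← addAnswer_comp_maskedMessage]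
  exact Protocol.applyBob_permUnitary_graphState _ _ _

theorem queryProtocol_state_odd (x : X) (y : Y) (j : ℕ) :
    (queryProtocol N e query answer out).state x y (2 * j + 1) =
      (queryProtocol N e query answer out).graphState
        (maskedMessage e (query x j) fun r => ∑ i ∈ Finset.range j, answer y (query x i r)) := by
  have : Subsingleton (queryProtocol N e query answer out).RegB :=
    inferInstanceAs (Subsingleton (Bits 0))
  induction j with
  | zero => exact Protocol.applyAlice_prepUnitary_state_zero _ x y _
  | succ j ih =>
    have requery_op : (queryProtocol N e query answer out).aliceOp (2 * (j + 1) + 1) x =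
        permUnitary ((Equiv.refl _).prodShear (requery e (query x j) (query x (j + 1)))) := by
      simp [Nat.mul_add_div]
    rw [Protocol.state, if_pos (odd_two_mul_add_one (j + 1)), requery_op,
      queryProtocol_state_even e ih]
    simp only [← Finset.sum_range_succ fun i => answer y (query x i _)]
    refine (Protocol.applyAlice_permUnitary_graphState _ _ _).trans ?_
    exact congrArg _ (funext (requery_maskedMessage e _ _ _))

theorem queryProtocol_lossA_eq_zero [Fintype X] [DecidableEq X] [Fintype Y] [DecidableEq Y]
    (hquery : ∀ x, ∀ j < N, Function.Bijective (query x j)) (μ : X × Y → ℝ) :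
    (queryProtocol N e query answer out).lossA μ = 0 := by
  refine Protocol.lossA_eq_zero _ (fun k hk hodd x x' y => ?_) μ
  obtain ⟨j, rfl⟩ := hodd
  have hj : j < N := by
    change 2 * j + 1 ≤ 2 * N at hk
    omega
  rw [Protocol.bobState_of_graphState _ (maskedMessage_bijective e (hquery x j hj) _)
      (queryProtocol_state_odd e x y j),
    Protocol.bobState_of_graphState _ (maskedMessage_bijective e (hquery x' j hj) _)
      (queryProtocol_state_odd e x' y j)]

theorem queryProtocol_computes [DecidableEq Z] (hN : 0 < N) {f : X → Y → Z}
    (hf : ∀ x y r, out (∑ j ∈ Finset.range N, answer y (query x j r)) = f x y) :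
    (queryProtocol N e query answer out).Computes f := by
  intro x y
  obtain ⟨j, rfl⟩ := Nat.exists_eq_succ_of_ne_zero hN.ne'
  refine Protocol.outputProb_eq_one _ ?_
  rintro ⟨a, w, b⟩ hne
  rw [Protocol.applyAlice_one, queryProtocol_state_even e (queryProtocol_state_odd e x y j)] at hne
  have message_eq : _ = w := apply_eq_of_graphKet_ne_zero hne
  rw [← hf x y (e a).1, Finset.sum_range_succ]
  simp [← message_eq, maskedMessage]

end QueryProtocol

/-! ### Querying the multilinear extension along a line -/

theorem sum_eval_pow_of_isPrimitiveRoot {F : Type*} [CommRing F] [IsDomain F] {ζ : F} {N : ℕ}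
    (hζ : IsPrimitiveRoot ζ N) {p : Polynomial F} (hp : p.natDegree < N) :
    ∑ j ∈ Finset.range N, p.eval (ζ ^ j) = N * p.eval 0 := by
  have geom_sum_eq_zero : ∀ k < N, k ≠ 0 → ∑ j ∈ Finset.range N, (ζ ^ j) ^ k = 0 := by
    intro k hk hk0
    have h : (∑ j ∈ Finset.range N, (ζ ^ k) ^ j) * (ζ ^ k - 1) = 0 := by
      rw [geom_sum_mul, pow_right_comm, hζ.pow_eq_one, one_pow, sub_self]
    simp only [pow_right_comm ζ _ k]
    exact (mul_eq_zero.mp h).resolve_right (sub_ne_zero.mpr (hζ.pow_ne_one_of_pos_of_lt hk0 hk))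
  simp only [Polynomial.eval_eq_sum_range' hp]
  rw [Finset.sum_comm, Finset.mul_sum]
  refine Finset.sum_congr rfl fun k hk => ?_
  rw [← Finset.mul_sum]
  obtain rfl | hk0 := eq_or_ne k 0
  · simp [mul_comm]
  · rw [geom_sum_eq_zero k (Finset.mem_range.mp hk) hk0, zero_pow hk0, mul_zero, mul_zero]

theorem exists_isPrimitiveRoot_card_sub_one (F : Type*) [Field F] [Fintype F] :
    ∃ ζ : F, IsPrimitiveRoot ζ (Fintype.card F - 1) := by
  classical
  obtain ⟨ζ, hζ⟩ := IsCyclic.exists_generator (α := Fˣ)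
  refine ⟨ζ, IsPrimitiveRoot.coe_units_iff.mpr ?_⟩
  rw [← Fintype.card_units, ← Nat.card_eq_fintype_card,
    ← orderOf_eq_card_of_forall_mem_zpowers hζ]
  exact IsPrimitiveRoot.orderOf ζ

section MultilinearExtension

variable {R R' ι κ : Type*} [CommRing R] [CommRing R'] [Fintype ι] [Fintype κ]

/-- The point with coordinates `0` and `1` given by a string of bits. -/
def bitPoint (b : κ → Bool) : κ → R := fun l => if b l then 1 else 0

/-- The value at `z` of the multilinear polynomial that takes the value `x i` at `bitPoint (ε i)`
and vanishes at the other points with coordinates `0` and `1`, for an injective encoding `ε` of the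
indices by bits. -/
def multilinearExt (ε : ι → κ → Bool) (x : ι → Bool) (z : κ → R) : R :=
  ∑ i, if x i then ∏ l, (if ε i l then z l else 1 - z l) else 0

theorem multilinearExt_bitPoint {ε : ι → κ → Bool} (hε : Function.Injective ε) (x : ι → Bool)
    (i : ι) : multilinearExt ε x (bitPoint (ε i) : κ → R) = if x i then 1 else 0 := by
  rw [multilinearExt, Fintype.sum_eq_single i]
  · rw [Finset.prod_eq_one]
    intro l _
    cases h : ε i l <;> simp [bitPoint, h]
  · intro k hk
    obtain ⟨l, hl⟩ : ∃ l, ε k l ≠ ε i l := Function.ne_iff.mp (hε.ne hk)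
    rw [Finset.prod_eq_zero (Finset.mem_univ l), ite_self]
    cases h : ε i l <;> cases h' : ε k l <;> simp_all [bitPoint]

theorem map_multilinearExt (f : R →+* R') (ε : ι → κ → Bool) (x : ι → Bool) (z : κ → R) :
    f (multilinearExt ε x z) = multilinearExt ε x (f ∘ z) := by
  simp [multilinearExt, apply_ite f, map_sum, map_prod]

theorem natDegree_multilinearExt_le (ε : ι → κ → Bool) (x : ι → Bool)
    {z : κ → Polynomial R} (hz : ∀ l, (z l).natDegree ≤ 1) :
    (multilinearExt ε x z).natDegree ≤ Fintype.card κ := by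
  refine Polynomial.natDegree_sum_le_of_forall_le _ _ fun i _ => ?_
  split_ifs
  · refine (Polynomial.natDegree_prod_le _ _).trans ?_
    refine (Finset.sum_le_card_nsmul _ _ 1 fun l _ => ?_).trans (by simp)
    split_ifs
    · exact hz l
    · exact (Polynomial.natDegree_sub_le _ _).trans (by simpa using hz l)
  · simp

theorem sum_multilinearExt_add_pow_smul [IsDomain R] {ζ : R} {N : ℕ} (hζ : IsPrimitiveRoot ζ N)
    (hN : Fintype.card κ < N) (ε : ι → κ → Bool) (x : ι → Bool) (u r : κ → R) :
    ∑ j ∈ Finset.range N, multilinearExt ε x (u + ζ ^ j • r) = N * multilinearExt ε x u := by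
  let line : κ → Polynomial R := fun l => Polynomial.C (u l) + Polynomial.X * Polynomial.C (r l)
  have eval_line : ∀ t, (multilinearExt ε x line).eval t = multilinearExt ε x (u + t • r) := by
    intro t
    rw [← Polynomial.coe_evalRingHom, map_multilinearExt]
    congr 1
    ext l
    simp [line, mul_comm t]
  have line_natDegree : ∀ l, (line l).natDegree ≤ 1 := fun l => by
    simp only [line]
    compute_degree
  have interpolation := sum_eval_pow_of_isPrimitiveRoot hζ
    ((natDegree_multilinearExt_le ε x line_natDegree).trans_lt hN)
  simpa only [eval_line, zero_smul, add_zero] using interpolation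

end MultilinearExtension

theorem exists_pirProtocol {n m s : ℕ} (hn : n ≤ 2 ^ m) (hs : m + 2 ≤ 2 ^ s) :
    ∃ π : Protocol (Fin n) (Fin n → Bool) Bool,
      π.Computes (index n) ∧ (∀ μ, π.lossA μ = 0) ∧
      π.rounds = 2 * (2 ^ s - 1) ∧ π.qubitsM = s * m + s := by
  have hs0 : s ≠ 0 := by
    rintro rfl
    simp at hs
  let F := GaloisField 2 s
  have : Fintype F := Fintype.ofFinite F
  have : DecidableEq F := Classical.decEq F
  have card_F : Fintype.card F = 2 ^ s := by
    rw [Fintype.card_eq_nat_card]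
    exact GaloisField.card 2 s hs0
  have cast_ne_zero : ((2 ^ s - 1 : ℕ) : F) ≠ 0 := by
    have : (2 : F) = 0 := CharTwo.two_eq_zero
    simp [Nat.cast_sub Nat.one_le_two_pow, this, hs0]
  obtain ⟨ζ, hζ⟩ := exists_isPrimitiveRoot_card_sub_one F
  rw [card_F] at hζ
  obtain ⟨ε⟩ : Nonempty (Fin n ↪ (Fin m → Bool)) :=
    Function.Embedding.nonempty_of_card_le (by simpa using hn)
  let e : Bits (s * m + s) ≃ (Fin m → F) × F := Fintype.equivOfCardEq (by
    simp [card_F, ← pow_mul, ← pow_add])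
  refine ⟨queryProtocol (2 ^ s - 1) e (fun i j r => bitPoint (ε i) + ζ ^ j • r)
    (fun x => multilinearExt ε x) (fun v => decide (v ≠ 0)), ?_, ?_, rfl, rfl⟩
  · refine queryProtocol_computes e (by omega) fun i x r => ?_
    rw [sum_multilinearExt_add_pow_smul hζ (by simp; omega), multilinearExt_bitPoint ε.injective]
    cases h : x i
    · simp [index, h]
    · simpa [index, h] using cast_ne_zero
  · refine queryProtocol_lossA_eq_zero e fun i j _ => ?_
    have smul_bijective : Function.Bijective fun r : Fin m → F => ζ ^ j • r :=
      MulAction.bijective₀ (pow_ne_zero j (hζ.ne_zero (by omega)))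
    exact (Equiv.addLeft _).bijective.comp smul_bijective

/-! ### Choice of parameters -/

theorem clog_two_lt_logb_add_one {n : ℕ} (hn : 1 ≤ n) :
    (Nat.clog 2 n : ℝ) < Real.logb 2 n + 1 := by
  rw [← Real.natCeil_logb_natCast]
  exact Nat.ceil_lt_add_one (Real.logb_nonneg one_lt_two (by exact_mod_cast hn))

theorem two_pow_clog_le {k : ℕ} (hk : 2 ≤ k) : 2 ^ Nat.clog 2 k ≤ 2 * k := by
  have lt_self := Nat.pow_pred_clog_lt_self one_lt_two hk
  obtain ⟨l, hl⟩ := Nat.exists_eq_add_of_le' (Nat.clog_pos one_lt_two hk)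
  rw [hl, Nat.pred_succ] at lt_self
  rw [hl, pow_succ]
  omega

theorem logb_two_le_self {x : ℝ} (hx : 1 ≤ x) : Real.logb 2 x ≤ x := by
  rw [Real.logb_le_iff_le_rpow one_lt_two (by linarith)]
  have := one_add_mul_self_le_rpow_one_add (s := 1) (by norm_num) hx
  norm_num at this
  linarith

theorem four_le_logb_two {n : ℕ} (hn : 16 ≤ n) : 4 ≤ Real.logb 2 n := by
  rw [Real.le_logb_iff_rpow_le one_lt_two (by positivity)]
  norm_num
  exact_mod_cast hn

theorem clog_add_two_le {n : ℕ} (hn : 16 ≤ n) :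
    ((Nat.clog 2 n + 2 : ℕ) : ℝ) ≤ 2 * Real.logb 2 n := by
  have := clog_two_lt_logb_add_one (n := n) (by omega)
  have := four_le_logb_two hn
  push_cast
  linarith

theorem clog_clog_add_two_le {n : ℕ} (hn : 16 ≤ n) :
    (Nat.clog 2 (Nat.clog 2 n + 2) : ℝ) ≤ 2 * Real.logb 2 (Real.logb 2 n) := by
  have four_le := four_le_logb_two hn
  have two_le : 2 ≤ Real.logb 2 (Real.logb 2 n) := by
    rw [Real.le_logb_iff_rpow_le one_lt_two (by linarith)]
    norm_num
    exact four_le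
  have clog_lt := clog_two_lt_logb_add_one (n := Nat.clog 2 n + 2) (by omega)
  have logb_le : Real.logb 2 ((Nat.clog 2 n + 2 : ℕ) : ℝ) ≤ Real.logb 2 (2 * Real.logb 2 n) :=
    Real.logb_le_logb_of_le one_lt_two (by positivity) (clog_add_two_le hn)
  rw [Real.logb_mul two_ne_zero (by linarith), Real.logb_self_eq_one one_lt_two] at logb_le
  linarith

theorem exists_pirProtocol_communication_le (n : ℕ) :
    ∃ π : Protocol (Fin n) (Fin n → Bool) Bool,
      π.Computes (index n) ∧ (∀ μ, π.lossA μ = 0) ∧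
      (16 ≤ n → (π.communication : ℝ) ≤
        32 * (Real.logb 2 n ^ 2 * Real.logb 2 (Real.logb 2 n))) := by
  obtain ⟨π, computes, lossA, rounds, qubitsM⟩ := exists_pirProtocol
    (Nat.le_pow_clog one_lt_two n) (Nat.le_pow_clog one_lt_two (Nat.clog 2 n + 2))
  refine ⟨π, computes, lossA, fun hn => ?_⟩
  set m := Nat.clog 2 n
  set s := Nat.clog 2 (m + 2)
  have hm : ((m + 2 : ℕ) : ℝ) ≤ 2 * Real.logb 2 n := clog_add_two_le hn
  have hs : (s : ℝ) ≤ 2 * Real.logb 2 (Real.logb 2 n) := clog_clog_add_two_le hn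
  have field_size : 2 ^ s ≤ 2 * (m + 2) := two_pow_clog_le (by omega)
  have communication_le : π.communication ≤ 4 * (m + 2) * (s * (m + 2)) := by
    rw [Protocol.communication, rounds, qubitsM, ← mul_add_one]
    exact Nat.mul_le_mul (by omega) (Nat.mul_le_mul_left s (by omega))
  calc (π.communication : ℝ) ≤ 4 * ((m + 2 : ℕ) : ℝ) * (s * ((m + 2 : ℕ) : ℝ)) := by
        exact_mod_cast communication_le
    _ ≤ 4 * (2 * Real.logb 2 n) *
        (2 * Real.logb 2 (Real.logb 2 n) * (2 * Real.logb 2 n)) := by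
        have := four_le_logb_two hn
        gcongr
        exact (Nat.cast_nonneg s).trans hs
    _ = 32 * (Real.logb 2 n ^ 2 * Real.logb 2 (Real.logb 2 n)) := by ring

end QPIR


theorem mainTheorem4 :
    ∃ π : (n : ℕ) → QPIR.Protocol (Fin n) (Fin n → Bool) Bool,
      (∀ n, (π n).Computes (QPIR.index n)) ∧
      ((fun n => ((π n).communication : ℝ)) =O[atTop]
        fun n : ℕ => Real.logb 2 n ^ 2 * Real.logb 2 (Real.logb 2 n)) ∧
      (∀ n, ∀ μ ∈ stdSimplex ℝ (Fin n × (Fin n → Bool)), (π n).lossA μ = 0) ∧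
      ∃ c : ℕ, ∃ C : ℝ, ∀ᶠ n : ℕ in atTop, ∀ μ ∈ stdSimplex ℝ (Fin n × (Fin n → Bool)),
        (π n).lossB μ ≤ C * Real.logb 2 n ^ c := by
  choose π computes lossA communication_le using QPIR.exists_pirProtocol_communication_le
  refine ⟨π, computes, IsBigO.of_bound 32 ?_, fun n μ _ => lossA n μ, 3, 32, ?_⟩
  · filter_upwards [eventually_ge_atTop 16] with n hn
    rw [Real.norm_of_nonneg (Nat.cast_nonneg _)]
    exact (communication_le n hn).trans (by gcongr; exact le_abs_self _)
  · filter_upwards [eventually_ge_atTop 16] with n hn μ hμ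
    have one_le : 1 ≤ Real.logb 2 n := by linarith [QPIR.four_le_logb_two hn]
    calc (π n).lossB μ ≤ (π n).communication := (π n).lossB_le_communication hμ
      _ ≤ 32 * (Real.logb 2 n ^ 2 * Real.logb 2 (Real.logb 2 n)) := communication_le n hn
      _ ≤ 32 * (Real.logb 2 n ^ 2 * Real.logb 2 n) := by
        gcongr 32 * (_ * ?_)
        exact QPIR.logb_two_le_self one_le
      _ = 32 * Real.logb 2 n ^ 3 := by ring
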